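/- Let $n\in\mathbb{N}$, $0<\beta<1$, $0\le\alpha<n$, $0<\alpha+\beta<n$, and let $b\in L^1_{\rm loc}(\mathbb{R}^n)$ be real-valued. A Young function is a convex, left-continuous $\Phi:[0,\infty)\to[0,\infty]$ with $\lim_{r\to0+}\Phi(r)=\Phi(0)=0$ and $\lim_{r\to\infty}\Phi(r)=\infty$; put $\Phi^{-1}(s)=\inf\{r\ge0:\Phi(r)>s\}$. Let $\Phi,\Psi$ be Young functions with $0<\Phi(r)<\infty$ for all $0<r<\infty$. Let $L^\Phi(\mathbb{R}^n)$ be the Orlicz space of all $f\in L^1_{\rm loc}(\mathbb{R}^n)$ with $\int_{\mathbb{R}^n}\Phi(k|f|)\,dx<\infty$ for some $k>0$, with $\|f\|_{L^\Phi}=\inf\{\lambda>0:\int_{\mathbb{R}^n}\Phi(|f|/\lambda)\,dx\le1\}$, and let $WL^\Psi(\mathbb{R}^n)$ be the weak Orlicz space of all $g\in L^1_{\rm loc}(\mathbb{R}^n)$ with $\|g\|_{WL^\Psi}=\inf\{\lambda>0:\sup_{t>0}\Psi(t)\,|\{x:|g(x)|/\lambda>t\}|\le1\}<\infty$. Let $$M_{b,\alpha}f(x)=\sup_{B\ni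 x}|B|^{-1+\frac{\alpha}{n}}\int_B|b(x)-b(y)||f(y)|\,dy,$$ the supremum being over all balls $B\subset\mathbb{R}^n$ containing $x$. "$M_{b,\alpha}$ is bounded from $L^\Phi$ to $WL^\Psi$" means that there is $C<\infty$ such that for every $f\in L^\Phi(\mathbb{R}^n)$ one has $M_{b,\alpha}f\in WL^\Psi(\mathbb{R}^n)$ and $\|M_{b,\alpha}f\|_{WL^\Psi}\le C\|f\|_{L^\Phi}$. "$b\in\dot\Lambda_\beta(\mathbb{R}^n)$" means that, after modification on a null set, $|b(x)-b(y)|\le C|x-y|^\beta$ for all $x,y\in\mathbb{R}^n$ and some constant $C$. A function $h:(0,\infty)\to[0,\infty]$ is almost decreasing if, for some constant $C>0$, $h(t)\le C\,h(s)$ whenever $0<s\le t$. Consider the conditions $$\text{(A)}\quad t^{-\frac{\alpha+\beta}{n}}\Phi^{-1}(t)\le C\,\Psi^{-1}(t)\ \text{ for all } t>0,\qquad \text{(B)}\quad \Psi^{-1}(t)\le C\,\Phi^{-1}(t)\,t^{-\frac{\alpha+\beta}{n}}\ \text{ for all } t>0,$$ each with some constant $C>0$ independent of $t$. Then: 1.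 If (A) holds and $b\in\dot\Lambda_\beta(\mathbb{R}^n)$, then $M_{b,\alpha}$ is bounded from $L^\Phi(\mathbb{R}^n)$ to $WL^\Psi(\mathbb{R}^n)$. 2. If (B) holds, $t^{1+\varepsilon}/\Psi(t)$ is almost decreasing for some $\varepsilon>0$ (with values in $[0,\infty]$, the quotient being $\infty$ where $\Psi(t)=0$ and $0$ where $\Psi(t)=\infty$), and $M_{b,\alpha}$ is bounded from $L^\Phi(\mathbb{R}^n)$ to $WL^\Psi(\mathbb{R}^n)$, then $b\in\dot\Lambda_\beta(\mathbb{R}^n)$. 3. If (A) and (B) hold and $t^{1+\varepsilon}/\Psi(t)$ is almost decreasing for some $\varepsilon>0$, then $b\in\dot\Lambda_\beta(\mathbb{R}^n)$ if and only if $M_{b,\alpha}$ is bounded from $L^\Phi(\mathbb{R}^n)$ to $WL^\Psi(\mathbb{R}^n)$. -/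

import Mathlib

open MeasureTheory Filter Topology Set
open scoped NNReal ENNReal

noncomputable section

namespace OrliczComm

/-- Young functions `Φ : [0,∞) → [0,∞]`. -/
structure IsYoung (Φ : ℝ≥0 → ℝ≥0∞) : Prop where
  convex : ConvexOn ℝ≥0 univ Φ
  left_continuous : ∀ r, ContinuousWithinAt Φ (Iic r) r
  map_zero : Φ 0 = 0
  tendsto_zero : Tendsto Φ (𝓝[>] 0) (𝓝 0)
  tendsto_top : Tendsto Φ atTop (𝓝 ∞)

/-- The class `𝒴` of Young functions that are positive and finite on `(0,∞)`. -/
structure IsYoungY (Φ : ℝ≥0 → ℝ≥0∞) : Prop extends IsYoung Φ where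
  pos : ∀ r, 0 < r → 0 < Φ r
  lt_top : ∀ r, 0 < r → Φ r < ∞

/-- The generalized inverse `Φ⁻¹(s) = inf {r ≥ 0 : Φ(r) > s}` for `0 ≤ s ≤ ∞` (`inf ∅ = ∞`). -/
def youngInv (Φ : ℝ≥0 → ℝ≥0∞) (s : ℝ≥0∞) : ℝ≥0∞ :=
  ⨅ (r : ℝ≥0) (_ : s < Φ r), (r : ℝ≥0∞)

variable {n : ℕ}

/-- Membership in the Orlicz space `L^Φ(ℝⁿ)`. -/
def MemOrlicz (Φ : ℝ≥0 → ℝ≥0∞) (f : EuclideanSpace ℝ (Fin n) → ℝ) : Prop :=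
  LocallyIntegrable f volume ∧ ∃ k : ℝ≥0, 0 < k ∧ ∫⁻ x, Φ (k * ‖f x‖₊) < ∞

/-- The Luxemburg norm on `L^Φ(ℝⁿ)`. -/
def orliczNorm (Φ : ℝ≥0 → ℝ≥0∞) (f : EuclideanSpace ℝ (Fin n) → ℝ) : ℝ≥0∞ :=
  ⨅ (l : ℝ≥0) (_ : 0 < l ∧ ∫⁻ x, Φ (‖f x‖₊ / l) ≤ 1), (l : ℝ≥0∞)

/-- The weak Orlicz norm of a nonnegative function:
the infimum of all `l > 0` with `sup_{t > 0} Ψ(t) |{x : g(x) / l > t}| ≤ 1`. -/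
def weakOrliczNorm (Ψ : ℝ≥0 → ℝ≥0∞) (g : EuclideanSpace ℝ (Fin n) → ℝ≥0∞) : ℝ≥0∞ :=
  ⨅ (l : ℝ≥0)
    (_ : 0 < l ∧ (⨆ (t : ℝ≥0) (_ : 0 < t), Ψ t * volume {x | (t : ℝ≥0∞) < g x / l}) ≤ 1),
    (l : ℝ≥0∞)

/-- Membership of a nonnegative function in the weak Orlicz space `WL^Ψ(ℝⁿ)`. -/
def MemWeakOrlicz (Ψ : ℝ≥0 → ℝ≥0∞) (g : EuclideanSpace ℝ (Fin n) → ℝ≥0∞) : Prop :=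
  LocallyIntegrable g volume ∧ weakOrliczNorm Ψ g < ∞

/-- The fractional maximal commutator
`M_{b,α} f(x) = sup_{B ∋ x} |B|^{-1+α/n} ∫_B |b(x) - b(y)| |f(y)| dy`, over balls `B`. -/
def maxComm (b : EuclideanSpace ℝ (Fin n) → ℝ) (α : ℝ) (f : EuclideanSpace ℝ (Fin n) → ℝ)
    (x : EuclideanSpace ℝ (Fin n)) : ℝ≥0∞ :=
  ⨆ (c : EuclideanSpace ℝ (Fin n)) (r : ℝ) (_ : 0 < r ∧ x ∈ Metric.ball c r),
    volume (Metric.ball c r) ^ (-1 + α / (n : ℝ)) *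
      ∫⁻ y in Metric.ball c r, ‖b x - b y‖ₑ * ‖f y‖ₑ

/-- `M_{b,α}` is bounded from `L^Φ(ℝⁿ)` to `WL^Ψ(ℝⁿ)`. -/
def MaxCommWeakBounded (b : EuclideanSpace ℝ (Fin n) → ℝ) (α : ℝ) (Φ Ψ : ℝ≥0 → ℝ≥0∞) : Prop :=
  ∃ C : ℝ≥0, ∀ f : EuclideanSpace ℝ (Fin n) → ℝ, MemOrlicz Φ f →
    MemWeakOrlicz Ψ (maxComm b α f) ∧
      weakOrliczNorm Ψ (maxComm b α f) ≤ C * orliczNorm Φ f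

/-- Membership of (the almost-everywhere class of) `b` in the Lipschitz space `Λ̇_β(ℝⁿ)`. -/
def MemLip (β : ℝ) (b : EuclideanSpace ℝ (Fin n) → ℝ) : Prop :=
  ∃ b' : EuclideanSpace ℝ (Fin n) → ℝ, b =ᵐ[volume] b' ∧
    ∃ C : ℝ, ∀ x y, |b' x - b' y| ≤ C * ‖x - y‖ ^ β

/-- `g` is almost decreasing on `(0,∞)`. -/
def AlmostDecreasing (g : ℝ≥0 → ℝ≥0∞) : Prop :=
  ∃ C : ℝ≥0, 0 < C ∧ ∀ s t : ℝ≥0, 0 < s → s ≤ t → g t ≤ C * g s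

/-- `t^{-γ} Φ⁻¹(t) ≲ Ψ⁻¹(t)` for all `t > 0`. -/
def InvLower (γ : ℝ) (Φ Ψ : ℝ≥0 → ℝ≥0∞) : Prop :=
  ∃ C : ℝ≥0, 0 < C ∧ ∀ t : ℝ≥0, 0 < t →
    (t : ℝ≥0∞) ^ (-γ) * youngInv Φ t ≤ C * youngInv Ψ t

/-- `Ψ⁻¹(t) ≲ Φ⁻¹(t) t^{-γ}` for all `t > 0`. -/
def InvUpper (γ : ℝ) (Φ Ψ : ℝ≥0 → ℝ≥0∞) : Prop :=
  ∃ C : ℝ≥0, 0 < C ∧ ∀ t : ℝ≥0, 0 < t →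
    youngInv Ψ t ≤ C * (youngInv Φ t * (t : ℝ≥0∞) ^ (-γ))

end OrliczComm

end

/-! Put γ = (α+β)/n.

Sufficiency. If b is β-Hölder, then |b(x) - b(y)| ≲ |B|^{β/n} for x, y in a ball B, so M_{b,α} f is
dominated pointwise by a constant times the fractional maximal function `fracMax` of order γ.
Normalise ∫ Φ(|f|) ≤ 1 and let A be the mean of Φ(|f|) over B, so that A ≤ 1/|B|. Jensen and
condition (A) at t = A give |B|^{γ-1} ∫_B |f| ≲ A^{-γ} Φ⁻¹(A) ≲ Ψ⁻¹(A). Where `fracMax` exceeds a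
multiple of t, some ball therefore satisfies Ψ(t) |B| ≤ ∫_B Φ(|f|), and Vitali's covering lemma
yields the weak bound (`mul_volume_fracMax_le`). Since Ψ need not grow faster than linearly, this
bound alone does not give local integrability of M_{b,α} f; that comes from comparison with a
truncated Riesz potential (`lintegral_ball_fracMax_lt_top`), where 0 < γ < 1 enters.

Necessity. Test on the indicator of B: its Luxemburg norm is ≲ 1/Φ⁻¹(1/|B|), while on B its image is
at least |B|^{α/n} |b - b_B|, with b_B the mean of b. The growth of Ψ upgrades the weak bound to an
L¹ bound on B, and (B) at t = 1/|B| turns it into ∫_B |b - b_B| ≲ |B|^{1+β/n}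
(`exists_lintegral_oscillation_le`). By Campanato's theorem (`memLip_of_lintegral_oscillation_le`) b
agrees almost everywhere with a β-Hölder function. -/

namespace OrliczComm

/-! ### Young functions, generalized inverses and a Jensen inequality -/

section Young

variable {Φ Ψ : ℝ≥0 → ℝ≥0∞}

theorem IsYoung.map_mul_le (hΦ : IsYoung Φ) {θ : ℝ≥0} (hθ : θ ≤ 1) (r : ℝ≥0) :
    Φ (θ * r) ≤ θ * Φ r := by
  have h := hΦ.convex.2 (mem_univ r) (mem_univ (0 : ℝ≥0)) (zero_le (a := θ))
    (zero_le (a := 1 - θ)) (add_tsub_cancel_of_le hθ)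
  simpa [hΦ.map_zero, ENNReal.smul_def] using h

theorem IsYoung.mono (hΦ : IsYoung Φ) : Monotone Φ := by
  intro s t hst
  rcases eq_or_ne t 0 with rfl | ht
  · rw [le_antisymm hst (zero_le)]
  have h1 : s / t ≤ 1 := div_le_one_of_le₀ hst (zero_le)
  have h := hΦ.map_mul_le h1 t
  rw [div_mul_cancel₀ _ ht] at h
  refine h.trans (mul_le_of_le_one_left (zero_le) ?_)
  exact_mod_cast h1

/-- By convexity Φ(s)/s is nondecreasing, so beyond r the second term alone dominates s. Integrating
this affine bound gives Jensen's inequality without using concavity of the inverse. -/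
theorem IsYoung.le_add_mul (hΦ : IsYoung Φ) {r : ℝ≥0} (h0 : Φ r ≠ 0) (h1 : Φ r ≠ ∞) (s : ℝ≥0) :
    (s : ℝ≥0∞) ≤ r + r / Φ r * Φ s := by
  rcases le_total s r with h | h
  · exact le_add_right (by exact_mod_cast h)
  refine le_add_left ?_
  rcases eq_or_ne s 0 with rfl | hs
  · simp
  have h2 := hΦ.map_mul_le (div_le_one_of_le₀ h (zero_le)) s
  rw [div_mul_cancel₀ _ hs, ENNReal.coe_div hs] at h2
  have hs' : (s : ℝ≥0∞) ≠ 0 := by exact_mod_cast hs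
  calc (s : ℝ≥0∞) = s / Φ r * Φ r := (ENNReal.div_mul_cancel h0 h1).symm
    _ ≤ s / Φ r * (r / s * Φ s) := by gcongr
    _ = (s / s) * (r / Φ r * Φ s) := by simp only [div_eq_mul_inv]; ring
    _ = _ := by rw [ENNReal.div_self hs' ENNReal.coe_ne_top, one_mul]

theorem youngInv_mono : Monotone (youngInv Φ) := fun _ _ h =>
  le_iInf₂ fun r hr => iInf₂_le r (h.trans_lt hr)

theorem youngInv_le {s : ℝ≥0∞} {r : ℝ≥0} (h : s < Φ r) : youngInv Φ s ≤ r := iInf₂_le r h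

theorem map_le_of_lt_youngInv {s : ℝ≥0∞} {r : ℝ≥0} (h : (r : ℝ≥0∞) < youngInv Φ s) : Φ r ≤ s :=
  not_lt.1 fun h' => (youngInv_le h').not_gt h

theorem IsYoung.lt_map_of_youngInv_lt (hΦ : IsYoung Φ) {s : ℝ≥0∞} {r : ℝ≥0}
    (h : youngInv Φ s < r) : s < Φ r := by
  simp only [youngInv, iInf_lt_iff] at h
  obtain ⟨q, hq, hqr⟩ := h
  exact hq.trans_le (hΦ.mono (by exact_mod_cast hqr.le))

theorem IsYoung.youngInv_pos (hΦ : IsYoung Φ) {s : ℝ≥0∞} (hs : 0 < s) : 0 < youngInv Φ s := by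
  obtain ⟨r, hr, hr0⟩ :=
    ((hΦ.tendsto_zero.eventually (gt_mem_nhds hs)).and self_mem_nhdsWithin).exists
  refine (ENNReal.coe_pos.2 hr0).trans_le (le_iInf₂ fun q hq => ?_)
  by_contra! hqr
  exact (hr.trans hq).not_ge (hΦ.mono (by exact_mod_cast hqr.le))

theorem IsYoung.youngInv_lt_top (hΦ : IsYoung Φ) {s : ℝ≥0∞} (hs : s ≠ ∞) : youngInv Φ s < ∞ := by
  obtain ⟨r, hr⟩ := (hΦ.tendsto_top.eventually (lt_mem_nhds hs.lt_top)).exists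
  exact (youngInv_le hr).trans_lt ENNReal.coe_lt_top

theorem IsYoungY.youngInv_zero (hΦ : IsYoungY Φ) : youngInv Φ 0 = 0 := by
  refine le_antisymm (ENNReal.le_of_forall_pos_le_add fun r hr _ => ?_) (zero_le)
  simpa using youngInv_le (hΦ.pos r hr)

/-- Jensen's inequality up to a factor `2`. -/
theorem IsYoungY.lintegral_le_youngInv {X : Type*} [MeasurableSpace X] (hΦ : IsYoungY Φ)
    (μ : Measure X) (h0 : μ univ ≠ 0) (h1 : μ univ ≠ ∞) (g : X → ℝ≥0) :
    (μ univ)⁻¹ * ∫⁻ x, g x ∂μ ≤ 2 * youngInv Φ ((μ univ)⁻¹ * ∫⁻ x, Φ (g x) ∂μ) := by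
  simp only [youngInv, ENNReal.mul_iInf_of_ne two_ne_zero ENNReal.ofNat_ne_top]
  refine le_iInf₂ fun r hr => ?_
  have hr0 : 0 < r := by
    rcases eq_or_lt_of_le (zero_le (a := r)) with rfl | h
    · simp [hΦ.map_zero] at hr
    · exact h
  have hp := (hΦ.pos r hr0).ne'
  have ht := (hΦ.lt_top r hr0).ne
  have hq : (r : ℝ≥0∞) / Φ r ≠ ∞ := ENNReal.div_ne_top ENNReal.coe_ne_top hp
  calc (μ univ)⁻¹ * ∫⁻ x, g x ∂μ ≤ (μ univ)⁻¹ * ∫⁻ x, (r + r / Φ r * Φ (g x)) ∂μ := by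
        gcongr with x; exact hΦ.le_add_mul hp ht (g x)
    _ = r * ((μ univ)⁻¹ * μ univ) + r / Φ r * ((μ univ)⁻¹ * ∫⁻ x, Φ (g x) ∂μ) := by
        rw [lintegral_add_left measurable_const, lintegral_const, lintegral_const_mul' _ _ hq]
        ring
    _ ≤ r * 1 + r / Φ r * Φ r := by
        gcongr
        exact (ENNReal.inv_mul_cancel h0 h1).le
    _ = 2 * r := by rw [ENNReal.div_mul_cancel hp ht]; ring

/-- The mean A of Φ(g) is at most 1/μ(X), hence μ(X)^γ ≤ A^{-γ}. After Jensen, the hypothesis is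
applied at t = A, not at 1/μ(X); keeping A on the right is what later allows a covering argument. -/
theorem rpow_mul_lintegral_le_youngInv {X : Type*} [MeasurableSpace X] (hΦ : IsYoungY Φ)
    {γ : ℝ} (hγ : 0 ≤ γ) {C : ℝ≥0}
    (hC : ∀ t : ℝ≥0, 0 < t → (t : ℝ≥0∞) ^ (-γ) * youngInv Φ t ≤ C * youngInv Ψ t)
    (μ : Measure X) (h0 : μ univ ≠ 0) (h1 : μ univ ≠ ∞) (g : X → ℝ≥0)
    (hg : ∫⁻ x, Φ (g x) ∂μ ≤ 1) :
    (μ univ) ^ (-1 + γ) * ∫⁻ x, g x ∂μ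
      ≤ 2 * C * youngInv Ψ ((μ univ)⁻¹ * ∫⁻ x, Φ (g x) ∂μ) := by
  have hJ := hΦ.lintegral_le_youngInv μ h0 h1 g
  have hVA : (μ univ)⁻¹ * ∫⁻ x, Φ (g x) ∂μ ≤ (μ univ)⁻¹ := mul_le_of_le_one_right (zero_le) hg
  rw [add_comm, ENNReal.rpow_add _ _ h0 h1, ENNReal.rpow_neg_one, mul_assoc]
  set A := (μ univ)⁻¹ * ∫⁻ x, Φ (g x) ∂μ with hA
  have hAt : A ≠ ∞ := (hVA.trans_lt (ENNReal.inv_lt_top.2 (pos_iff_ne_zero.2 h0))).ne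
  -- The comparison of inverses is assumed only for t > 0. If A = 0, positivity of Φ gives Φ⁻¹(0) =
  -- 0, and Jensen makes the left side vanish.
  rcases eq_or_ne A 0 with hA0 | hA0
  · rw [hA0, hΦ.youngInv_zero, mul_zero] at hJ
    rw [le_antisymm hJ (zero_le), mul_zero]
    exact zero_le
  have hC' := hC A.toNNReal (ENNReal.toNNReal_pos hA0 hAt)
  rw [ENNReal.coe_toNNReal hAt] at hC'
  calc μ univ ^ γ * ((μ univ)⁻¹ * ∫⁻ x, g x ∂μ) ≤ A ^ (-γ) * (2 * youngInv Φ A) := by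
        gcongr
        rw [ENNReal.rpow_neg, ← ENNReal.inv_rpow]
        exact ENNReal.rpow_le_rpow (ENNReal.le_inv_iff_le_inv.1 hVA) hγ
    _ = 2 * (A ^ (-γ) * youngInv Φ A) := by ring
    _ ≤ 2 * (C * youngInv Ψ A) := by gcongr
    _ = _ := by ring

end Young

/-! ### Vitali covering and the weak estimate for the fractional maximal function -/

variable {n : ℕ}

theorem volume_ball_eq (c : EuclideanSpace ℝ (Fin n)) {r : ℝ} (hr : 0 < r) :
    volume (Metric.ball c r) =
      ENNReal.ofReal r ^ n * volume (Metric.ball (0 : EuclideanSpace ℝ (Fin n)) 1) := by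
  rw [Measure.addHaar_ball_of_pos _ _ hr, finrank_euclideanSpace, Fintype.card_fin,
    ENNReal.ofReal_pow hr.le]

theorem volume_ball_mul (c : EuclideanSpace ℝ (Fin n)) {r s : ℝ} (hs : 0 < s) (hr : 0 < r) :
    volume (Metric.ball c (s * r)) = ENNReal.ofReal s ^ n * volume (Metric.ball c r) := by
  rw [volume_ball_eq c hr, volume_ball_eq c (mul_pos hs hr), ENNReal.ofReal_mul hs.le, mul_pow,
    mul_assoc]

/-- A weak-type estimate from Vitali's covering lemma. -/
theorem mul_volume_le_of_forall_exists_ball (hn : 0 < n) (ν : Measure (EuclideanSpace ℝ (Fin n)))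
    [IsFiniteMeasure ν] (κ : ℝ≥0∞) (S : Set (EuclideanSpace ℝ (Fin n)))
    (hS : ∀ x ∈ S, ∃ c r, 0 < r ∧ x ∈ Metric.ball c r ∧
      κ * volume (Metric.ball c r) ≤ ν (Metric.ball c r)) :
    κ * volume S ≤ 5 ^ n * ν univ := by
  rcases eq_or_ne κ 0 with rfl | hκ0
  · simp
  set ω := volume (Metric.ball (0 : EuclideanSpace ℝ (Fin n)) 1) with hω
  have hω0 : ω ≠ 0 := (Metric.measure_ball_pos _ _ one_pos).ne'
  have hωt : ω ≠ ∞ := measure_ball_lt_top.ne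
  let t : Set (EuclideanSpace ℝ (Fin n) × ℝ) :=
    {p | 0 < p.2 ∧ κ * volume (Metric.ball p.1 p.2) ≤ ν (Metric.ball p.1 p.2)}
  let D := ν univ / (κ * ω)
  have hD : D ≠ ∞ := ENNReal.div_ne_top (measure_ne_top _ _) (mul_ne_zero hκ0 hω0)
  -- Vitali needs bounded radii. Finiteness of ν bounds r^n, and r ≤ r^n when r ≥ 1.
  have hR : ∀ p ∈ t, p.2 ≤ max 1 D.toReal := by
    rintro ⟨c, r⟩ ⟨hr, hp⟩
    simp only at hr hp ⊢
    rcases le_total r 1 with h | h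
    · exact h.trans (le_max_left _ _)
    refine le_max_of_le_right ?_
    rw [← ENNReal.ofReal_le_iff_le_toReal hD, ENNReal.le_div_iff_mul_le
      (Or.inl (mul_ne_zero hκ0 hω0)) (Or.inr (measure_ne_top _ _))]
    rw [volume_ball_eq c hr] at hp
    calc ENNReal.ofReal r * (κ * ω) ≤ ENNReal.ofReal r ^ n * (κ * ω) := by
          gcongr
          exact le_self_pow₀ (by simpa using h) hn.ne'
      _ = κ * (ENNReal.ofReal r ^ n * ω) := by ring
      _ ≤ ν univ := hp.trans (measure_mono (subset_univ _))
  obtain ⟨u, hut, hdisj, hcov⟩ := Vitali.exists_disjoint_subfamily_covering_enlargement_ball t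
    Prod.fst Prod.snd _ hR 5 (by norm_num)
  have hcount : u.Countable := hdisj.countable_of_isOpen (fun _ _ => Metric.isOpen_ball)
    fun p hp => ⟨p.1, Metric.mem_ball_self (hut hp).1⟩
  have hsub : S ⊆ ⋃ p ∈ u, Metric.ball p.1 (5 * p.2) := by
    intro x hx
    obtain ⟨c, r, hr, hxr, h⟩ := hS x hx
    obtain ⟨p, hp, hsub⟩ := hcov (c, r) ⟨hr, h⟩
    exact mem_biUnion hp (hsub hxr)
  have : Countable u := hcount.to_subtype
  calc κ * volume S ≤ κ * ∑' p : u, volume (Metric.ball p.1.1 (5 * p.1.2)) := by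
        gcongr
        exact (measure_mono hsub).trans (measure_biUnion_le _ hcount _)
    _ = ∑' p : u, 5 ^ n * (κ * volume (Metric.ball p.1.1 p.1.2)) := by
        rw [← ENNReal.tsum_mul_left]
        refine tsum_congr fun p => ?_
        rw [volume_ball_mul _ (by norm_num) (hut p.2).1, ENNReal.ofReal_ofNat]
        ring
    _ ≤ ∑' p : u, 5 ^ n * ν (Metric.ball p.1.1 p.1.2) := by
        gcongr with p
        exact (hut p.2).2
    _ = 5 ^ n * ν (⋃ p ∈ u, Metric.ball p.1 p.2) := by
        rw [ENNReal.tsum_mul_left,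
          measure_biUnion hcount hdisj fun _ _ => Metric.isOpen_ball.measurableSet]
    _ ≤ 5 ^ n * ν univ := by gcongr; exact subset_univ _

/-- The fractional maximal function of order `γ n`. -/
noncomputable def fracMax (γ : ℝ) (g : EuclideanSpace ℝ (Fin n) → ℝ≥0)
    (x : EuclideanSpace ℝ (Fin n)) : ℝ≥0∞ :=
  ⨆ (c : EuclideanSpace ℝ (Fin n)) (r : ℝ) (_ : 0 < r ∧ x ∈ Metric.ball c r),
    volume (Metric.ball c r) ^ (-1 + γ) * ∫⁻ y in Metric.ball c r, g y

theorem le_fracMax (γ : ℝ) (g : EuclideanSpace ℝ (Fin n) → ℝ≥0)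
    {x c : EuclideanSpace ℝ (Fin n)} {r : ℝ} (hr : 0 < r) (hx : x ∈ Metric.ball c r) :
    volume (Metric.ball c r) ^ (-1 + γ) * ∫⁻ y in Metric.ball c r, g y ≤ fracMax γ g x :=
  le_iSup₂_of_le c r (le_iSup_of_le ⟨hr, hx⟩ le_rfl)

theorem fracMax_le_mul_div (γ : ℝ) (g : EuclideanSpace ℝ (Fin n) → ℝ≥0) {l : ℝ≥0} (hl : 0 < l)
    (x : EuclideanSpace ℝ (Fin n)) : fracMax γ g x ≤ l * fracMax γ (fun y => g y / l) x := by
  refine iSup₂_le fun c r => iSup_le fun h => ?_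
  refine le_trans (le_of_eq ?_) (mul_le_mul_right (le_fracMax γ (fun y => g y / l) h.1 h.2) _)
  rw [mul_left_comm, ← lintegral_const_mul' _ _ ENNReal.coe_ne_top]
  congr 2
  ext y
  rw [← ENNReal.coe_mul, mul_div_cancel₀ _ hl.ne']

variable {Φ Ψ : ℝ≥0 → ℝ≥0∞}

/-- At each point of the level set some ball has t < Ψ⁻¹(A), where A is the mean of Φ(g) on it. Then
Ψ(t) ≤ A, which is the density condition of the Vitali estimate for the measure Φ(g) dx, of mass at
most 1. -/
theorem mul_volume_fracMax_le (hn : 0 < n) (hΦ : IsYoungY Φ) {γ : ℝ} (hγ : 0 ≤ γ) {C : ℝ≥0}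
    (hC : ∀ t : ℝ≥0, 0 < t → (t : ℝ≥0∞) ^ (-γ) * youngInv Φ t ≤ C * youngInv Ψ t)
    (g : EuclideanSpace ℝ (Fin n) → ℝ≥0) (hg : ∫⁻ x, Φ (g x) ≤ 1) (t : ℝ≥0) :
    Ψ t * volume {x | 2 * C * t < fracMax γ g x} ≤ 5 ^ n := by
  let ν : Measure (EuclideanSpace ℝ (Fin n)) := volume.withDensity fun x => Φ (g x)
  have hν : ν univ ≤ 1 := by simpa [ν] using hg
  have : IsFiniteMeasure ν := ⟨hν.trans_lt ENNReal.one_lt_top⟩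
  refine (mul_volume_le_of_forall_exists_ball hn ν (Ψ t) _ fun x hx => ?_).trans
    (mul_le_of_le_one_right (zero_le) hν)
  simp only [fracMax, mem_ofPred_eq, lt_iSup_iff] at hx
  obtain ⟨c, r, ⟨hr, hxr⟩, hlt⟩ := hx
  refine ⟨c, r, hr, hxr, ?_⟩
  set B := Metric.ball c r
  have hB0 : volume.restrict B univ ≠ 0 := by
    simpa using (Metric.measure_ball_pos volume c hr).ne'
  have hBt : volume.restrict B univ ≠ ∞ := by simpa using measure_ball_lt_top.ne
  have key := rpow_mul_lintegral_le_youngInv hΦ hγ hC (volume.restrict B) hB0 hBt g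
    ((setLIntegral_le_lintegral _ _).trans hg)
  have := hlt.trans_le (by simpa using key)
  have h2 := map_le_of_lt_youngInv (lt_of_mul_lt_mul_left' this)
  rw [Measure.restrict_apply_univ] at hB0 hBt
  calc Ψ t * volume B ≤ (volume B)⁻¹ * (∫⁻ x in B, Φ (g x)) * volume B := by gcongr
    _ = (∫⁻ x in B, Φ (g x)) * ((volume B)⁻¹ * volume B) := by ring
    _ = ν B := by
      rw [ENNReal.inv_mul_cancel hB0 hBt, mul_one, withDensity_apply _ Metric.isOpen_ball.measurableSet]

/-! ### Maximal commutators: change of representative, measurability, pointwise domination -/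

theorem lintegral_enorm_ball_lt_top {f : EuclideanSpace ℝ (Fin n) → ℝ}
    (hf : LocallyIntegrable f volume) (c : EuclideanSpace ℝ (Fin n)) (r : ℝ) :
    ∫⁻ y in Metric.ball c r, ‖f y‖ₑ < ∞ :=
  ((hf.integrableOn_isCompact (isCompact_closedBall c r)).mono_set
    Metric.ball_subset_closedBall).2

theorem maxComm_congr {b b' : EuclideanSpace ℝ (Fin n) → ℝ} (h : b =ᵐ[volume] b') (α : ℝ)
    (f : EuclideanSpace ℝ (Fin n) → ℝ) : maxComm b α f =ᵐ[volume] maxComm b' α f := by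
  filter_upwards [h] with x hx
  simp only [maxComm]
  congr! 6 with c r hr
  refine lintegral_congr_ae ?_
  filter_upwards [ae_restrict_of_ae h] with y hy
  rw [hx, hy]

theorem weakOrliczNorm_congr (Ψ : ℝ≥0 → ℝ≥0∞) {g g' : EuclideanSpace ℝ (Fin n) → ℝ≥0∞}
    (h : g =ᵐ[volume] g') : weakOrliczNorm Ψ g = weakOrliczNorm Ψ g' := by
  have key : ∀ l t : ℝ≥0, volume {x | (t : ℝ≥0∞) < g x / l} = volume {x | (t : ℝ≥0∞) < g' x / l} := by
    intro l t
    refine measure_congr ?_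
    filter_upwards [h] with x hx
    exact propext (by change _ < _ ↔ _ < _; rw [hx])
  simp only [weakOrliczNorm, key]

/-- This supplies measurability, which an uncountable supremum does not give by itself. For a fixed
ball the integral varies by at most ‖b x₀ - b x‖ₑ times the integral of ‖f‖ₑ, and membership of x in
the ball is an open condition. -/
theorem lowerSemicontinuous_maxComm {b : EuclideanSpace ℝ (Fin n) → ℝ} (hb : Continuous b) (α : ℝ)
    {f : EuclideanSpace ℝ (Fin n) → ℝ} (hf : LocallyIntegrable f volume) :
    LowerSemicontinuous (maxComm b α f) := by
  refine lowerSemicontinuous_iSup fun c => lowerSemicontinuous_iSup fun r => ?_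
  intro x₀ y hy
  obtain ⟨⟨hr, hx⟩, hy⟩ := lt_iSup_iff.1 hy
  set V := volume (Metric.ball c r) ^ (-1 + α / (n : ℝ))
  have hV : V ≠ ∞ := ENNReal.rpow_ne_top_of_ne_zero
    (Metric.measure_ball_pos _ _ hr).ne' measure_ball_lt_top.ne
  set F := ∫⁻ y in Metric.ball c r, ‖f y‖ₑ
  have hF : F ≠ ∞ := (lintegral_enorm_ball_lt_top hf c r).ne
  set φ : EuclideanSpace ℝ (Fin n) → ℝ≥0∞ :=
    fun x => ∫⁻ y in Metric.ball c r, ‖b x - b y‖ₑ * ‖f y‖ₑ with hφ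
  have hle : ∀ x, V * φ x₀ - V * F * ‖b x₀ - b x‖ₑ ≤ V * φ x := by
    intro x
    rw [tsub_le_iff_right]
    calc V * φ x₀ ≤ V * (∫⁻ y in Metric.ball c r,
          (‖b x - b y‖ₑ * ‖f y‖ₑ + ‖b x₀ - b x‖ₑ * ‖f y‖ₑ)) := by
          gcongr
          refine lintegral_mono fun y => ?_
          rw [← add_mul]
          gcongr
          rw [← sub_add_sub_cancel (b x₀) (b x) (b y), add_comm]
          exact enorm_add_le _ _
      _ = V * (φ x + ‖b x₀ - b x‖ₑ * F) := by
          rw [lintegral_add_right', lintegral_const_mul' _ _ enorm_ne_top]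
          exact (hf.aestronglyMeasurable.enorm.restrict).const_mul _
      _ = _ := by ring
  have hlim : Tendsto (fun x => V * φ x₀ - V * F * ‖b x₀ - b x‖ₑ) (𝓝 x₀) (𝓝 (V * φ x₀)) := by
    have h0 : Tendsto (fun x => ‖b x₀ - b x‖ₑ) (𝓝 x₀) (𝓝 0) := by
      have : Continuous fun x => ‖b x₀ - b x‖ₑ := by fun_prop
      simpa using this.tendsto x₀
    have h1 : Tendsto (fun x => V * F * ‖b x₀ - b x‖ₑ) (𝓝 x₀) (𝓝 0) := by
      simpa using ENNReal.Tendsto.const_mul h0 (Or.inr (ENNReal.mul_ne_top hV hF))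
    simpa using ENNReal.Tendsto.sub tendsto_const_nhds h1 (Or.inr ENNReal.zero_ne_top)
  filter_upwards [hlim.eventually (lt_mem_nhds hy), Metric.isOpen_ball.mem_nhds hx] with x h1 h2
  exact lt_iSup_iff.2 ⟨⟨hr, h2⟩, h1.trans_le (hle x)⟩

theorem ofReal_rpow_eq_volume_ball (hn : 0 < n) (c : EuclideanSpace ℝ (Fin n)) {r : ℝ}
    (hr : 0 < r) (β : ℝ) :
    ENNReal.ofReal r ^ β = (volume (Metric.ball c r)
      / volume (Metric.ball (0 : EuclideanSpace ℝ (Fin n)) 1)) ^ (β / n) := by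
  have hω0 : volume (Metric.ball (0 : EuclideanSpace ℝ (Fin n)) 1) ≠ 0 :=
    (Metric.measure_ball_pos _ _ one_pos).ne'
  rw [volume_ball_eq c hr, ENNReal.mul_div_cancel_right hω0 measure_ball_lt_top.ne,
    ← ENNReal.rpow_natCast, ← ENNReal.rpow_mul, mul_div_cancel₀]
  exact_mod_cast hn.ne'

theorem exists_maxComm_le_mul_fracMax (hn : 0 < n) {α β : ℝ} (hβ : 0 ≤ β)
    {b : EuclideanSpace ℝ (Fin n) → ℝ} {C : ℝ} (hb : ∀ x y, |b x - b y| ≤ C * ‖x - y‖ ^ β) :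
    ∃ K : ℝ≥0, 0 < K ∧ ∀ (f : EuclideanSpace ℝ (Fin n) → ℝ) x,
      maxComm b α f x ≤ K * fracMax ((α + β) / n) (fun y => ‖f y‖₊) x := by
  set ω := volume (Metric.ball (0 : EuclideanSpace ℝ (Fin n)) 1) with hω
  have hω0 : ω ≠ 0 := (Metric.measure_ball_pos _ _ one_pos).ne'
  have hωt : ω ≠ ∞ := measure_ball_lt_top.ne
  set L : ℝ≥0∞ := ENNReal.ofReal C * (2 ^ β * (ω⁻¹) ^ (β / n)) with hL
  have hLt : L ≠ ∞ := by
    refine ENNReal.mul_ne_top ENNReal.ofReal_ne_top (ENNReal.mul_ne_top ?_ ?_)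
    · exact ENNReal.rpow_ne_top_of_nonneg hβ ENNReal.ofNat_ne_top
    · exact ENNReal.rpow_ne_top_of_nonneg (by positivity) (ENNReal.inv_ne_top.2 hω0)
  -- Adding 1 keeps the constant positive even when L = 0.
  refine ⟨L.toNNReal + 1, by positivity, fun f x => iSup₂_le fun c r => iSup_le fun ⟨hr, hx⟩ => ?_⟩
  set V := volume (Metric.ball c r) with hV
  have hV0 : V ≠ 0 := (Metric.measure_ball_pos _ _ hr).ne'
  have hVt : V ≠ ∞ := measure_ball_lt_top.ne
  have hosc : ∀ y ∈ Metric.ball c r, ‖b x - b y‖ₑ ≤ L * V ^ (β / n) := by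
    intro y hy
    have hxy : ‖x - y‖ ≤ 2 * r := by
      rw [← dist_eq_norm]
      have := dist_triangle_right x y c
      rw [Metric.mem_ball] at hx hy
      linarith
    calc ‖b x - b y‖ₑ = ENNReal.ofReal |b x - b y| := by
          rw [Real.enorm_eq_ofReal_abs]
      _ ≤ ENNReal.ofReal (C * ‖x - y‖ ^ β) := ENNReal.ofReal_le_ofReal (hb x y)
      _ = ENNReal.ofReal C * ENNReal.ofReal ‖x - y‖ ^ β := by
          rw [ENNReal.ofReal_mul' (by positivity), ENNReal.ofReal_rpow_of_nonneg (norm_nonneg _) hβ]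
      _ ≤ ENNReal.ofReal C * ENNReal.ofReal (2 * r) ^ β := by gcongr
      _ = L * V ^ (β / n) := by
          rw [ENNReal.ofReal_mul zero_le_two, ENNReal.mul_rpow_of_nonneg _ _ hβ,
            ofReal_rpow_eq_volume_ball hn c hr, ← hω, ← hV, div_eq_mul_inv,
            ENNReal.mul_rpow_of_nonneg _ _ (by positivity), ENNReal.ofReal_ofNat]
          ring
  calc V ^ (-1 + α / (n : ℝ)) * ∫⁻ y in Metric.ball c r, ‖b x - b y‖ₑ * ‖f y‖ₑ
      ≤ V ^ (-1 + α / (n : ℝ)) * ∫⁻ y in Metric.ball c r, L * V ^ (β / n) * ‖f y‖ₑ := by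
        gcongr 1
        exact setLIntegral_mono' Metric.isOpen_ball.measurableSet
          fun y hy => by gcongr; exact hosc y hy
    _ = L * ((V ^ (-1 + α / (n : ℝ)) * V ^ (β / n)) * ∫⁻ y in Metric.ball c r, ‖f y‖ₑ) := by
        rw [lintegral_const_mul']
        · ring
        · exact ENNReal.mul_ne_top hLt (ENNReal.rpow_ne_top_of_nonneg (by positivity) hVt)
    _ = L * (V ^ (-1 + (α + β) / (n : ℝ)) * ∫⁻ y in Metric.ball c r, ‖f y‖ₑ) := by
        rw [← ENNReal.rpow_add _ _ hV0 hVt]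
        congr 3
        ring
    _ ≤ _ := by
        gcongr
        · rw [ENNReal.coe_add, ENNReal.coe_toNNReal hLt]
          exact le_self_add
        · exact le_fracMax _ (fun y => ‖f y‖₊) hr hx

theorem continuous_of_abs_sub_le_rpow {b : EuclideanSpace ℝ (Fin n) → ℝ} {β C : ℝ} (hβ : 0 < β)
    (hb : ∀ x y, |b x - b y| ≤ C * ‖x - y‖ ^ β) : Continuous b := by
  rw [continuous_iff_continuousAt]
  intro x₀
  rw [ContinuousAt, tendsto_iff_dist_tendsto_zero]
  refine squeeze_zero (fun _ => dist_nonneg) (fun x => hb x x₀) ?_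
  have h : Continuous fun x => C * ‖x - x₀‖ ^ β :=
    continuous_const.mul ((continuous_id.sub continuous_const).norm.rpow_const
      fun _ => Or.inr hβ.le)
  simpa [Real.zero_rpow hβ.ne'] using h.tendsto x₀

/-! ### Local integrability of the fractional maximal function -/

theorem lintegral_ball_enorm_rpow_lt_top (hn : 0 < n) {a : ℝ} (ha : a < n) (R : ℝ) :
    ∫⁻ z in Metric.ball (0 : EuclideanSpace ℝ (Fin n)) R, ‖z‖ₑ ^ (-a) < ∞ := by
  have : Nonempty (Fin n) := ⟨⟨0, hn⟩⟩
  have h : IntegrableOn (fun z : EuclideanSpace ℝ (Fin n) => ‖z‖ ^ (-a)) (Metric.ball 0 R) := by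
    refine integrableOn_ball_of_norm_le_rpow (C := 1) (α := a) ?_ ?_ (ae_of_all _ fun z => ?_) ?_
    · simpa using Nat.one_le_iff_ne_zero.2 hn.ne'
    · simpa using ha
    · rw [one_mul, Real.norm_of_nonneg (by positivity)]
    · exact (measurable_norm.pow_const _).aestronglyMeasurable
  refine lt_of_eq_of_lt (lintegral_congr_ae ?_) h.2
  filter_upwards [ae_restrict_of_ae (Measure.ae_ne volume 0)] with z hz
  rw [Real.enorm_eq_ofReal (by positivity), ← ofReal_norm, ENNReal.ofReal_rpow_of_pos]
  exact norm_pos_iff.2 hz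

/-- Balls of radius at least 1 contribute a bounded amount. Smaller balls are controlled by a Riesz
kernel of exponent -n(1-γ), truncated to a ball; γ > 0 makes it integrable, and Tonelli concludes.
-/
theorem lintegral_ball_fracMax_lt_top (hn : 0 < n) (hΦ : IsYoungY Φ) (hΨ : IsYoung Ψ) {γ : ℝ}
    (hγ : 0 < γ) (hγ1 : γ < 1) {C : ℝ≥0}
    (hC : ∀ t : ℝ≥0, 0 < t → (t : ℝ≥0∞) ^ (-γ) * youngInv Φ t ≤ C * youngInv Ψ t)
    {g : EuclideanSpace ℝ (Fin n) → ℝ≥0} (hgm : AEMeasurable g) (hg : ∫⁻ x, Φ (g x) ≤ 1)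
    (hloc : ∀ c r, ∫⁻ y in Metric.ball c r, g y < ∞) (x₀ : EuclideanSpace ℝ (Fin n)) :
    ∫⁻ x in Metric.ball x₀ 1, fracMax γ g x < ∞ := by
  set ω := volume (Metric.ball (0 : EuclideanSpace ℝ (Fin n)) 1) with hω
  have hω0 : ω ≠ 0 := (Metric.measure_ball_pos _ _ one_pos).ne'
  have hωt : ω ≠ ∞ := measure_ball_lt_top.ne
  have hn' : (0 : ℝ) < n := by exact_mod_cast hn
  set T : ℝ≥0∞ := 2 * C * youngInv Ψ ω⁻¹ with hT
  have hTt : T ≠ ∞ := ENNReal.mul_ne_top (ENNReal.mul_ne_top ENNReal.ofNat_ne_top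
    ENNReal.coe_ne_top) (hΨ.youngInv_lt_top (ENNReal.inv_ne_top.2 hω0)).ne
  set a : ℝ := n * (1 - γ) with ha
  have ha0 : 0 ≤ a := by have : 0 ≤ 1 - γ := by linarith
                         positivity
  have han : a < n := by nlinarith
  set k : EuclideanSpace ℝ (Fin n) → ℝ≥0∞ :=
    (Metric.ball 0 4).indicator fun z => ‖z‖ₑ ^ (-a) with hk
  have hkm : Measurable k :=
    (measurable_enorm.pow_const _).indicator Metric.isOpen_ball.measurableSet
  set K : ℝ≥0∞ := ω ^ (-1 + γ) * 2 ^ a with hK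
  have hKt : K ≠ ∞ := ENNReal.mul_ne_top (ENNReal.rpow_ne_top_of_ne_zero hω0 hωt)
    (ENNReal.rpow_ne_top_of_nonneg ha0 ENNReal.ofNat_ne_top)
  have hbound : ∀ x ∈ Metric.ball x₀ 1, fracMax γ g x ≤
      T + K * ∫⁻ y in Metric.ball x₀ 3, k (x - y) * g y := by
    intro x hx0
    refine iSup₂_le fun c r => iSup_le fun ⟨hr, hx⟩ => ?_
    -- If r ≥ 1 the mean of Φ(g) is at most 1/|B| ≤ 1/ω, whence the bound T. If r ≤ 1, then
    -- |B|^{γ-1} is a constant times r^{-a}, and |x - y| < 2r on the ball gives r^{-a} ≤ 2^a |x -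
    -- y|^{-a}.
    rcases le_total 1 r with h1 | h1
    · refine le_add_right ?_
      have hB0 : volume.restrict (Metric.ball c r) univ ≠ 0 := by
        simpa using (Metric.measure_ball_pos volume c hr).ne'
      have hBt : volume.restrict (Metric.ball c r) univ ≠ ∞ := by
        simpa using measure_ball_lt_top.ne
      have hI := (setLIntegral_le_lintegral (Metric.ball c r) _).trans hg
      have key := rpow_mul_lintegral_le_youngInv hΦ hγ.le hC _ hB0 hBt g hI
      rw [Measure.restrict_apply_univ] at key
      refine key.trans ?_
      rw [hT]
      gcongr
      refine youngInv_mono (le_trans (mul_le_of_le_one_right (zero_le) hI) ?_)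
      rw [ENNReal.inv_le_inv, volume_ball_eq c hr]
      refine le_mul_of_one_le_left (zero_le) (one_le_pow₀ ?_)
      simpa using h1
    · refine le_add_left ?_
      have hsub : Metric.ball c r ⊆ Metric.ball x₀ 3 := by
        intro y hy
        rw [Metric.mem_ball] at *
        have h2 := dist_triangle y c x₀
        have h3 := dist_triangle c x x₀
        rw [dist_comm] at hx
        linarith
      have hV : volume (Metric.ball c r) ^ (-1 + γ)
          = ω ^ (-1 + γ) * ENNReal.ofReal r ^ (-a) := by
        rw [volume_ball_eq c hr, ENNReal.mul_rpow_of_ne_top (by finiteness) hωt, mul_comm,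
          ← ENNReal.rpow_natCast, ← ENNReal.rpow_mul]
        congr 2
        rw [ha]; ring
      have hker : ∀ y ∈ Metric.ball c r, ENNReal.ofReal r ^ (-a) ≤ 2 ^ a * k (x - y) := by
        intro y hy
        have hxy : ‖x - y‖ < 2 * r := by
          rw [← dist_eq_norm]
          have := dist_triangle_right x y c
          rw [Metric.mem_ball] at hx hy
          linarith
        rw [hk, indicator_of_mem (by rw [mem_ball_zero_iff]; linarith)]
        have h2a : (2 : ℝ≥0∞) ^ a ≠ 0 := by
          simp [ENNReal.rpow_eq_zero_iff]
        have h2t : (2 : ℝ≥0∞) ^ a ≠ ∞ := ENNReal.rpow_ne_top_of_nonneg ha0 ENNReal.ofNat_ne_top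
        calc ENNReal.ofReal r ^ (-a)
            = 2 ^ a * ((2 : ℝ≥0∞) ^ (-a) * ENNReal.ofReal r ^ (-a)) := by
              rw [← mul_assoc, ENNReal.rpow_neg 2, ENNReal.mul_inv_cancel h2a h2t, one_mul]
          _ = 2 ^ a * ENNReal.ofReal (2 * r) ^ (-a) := by
              rw [ENNReal.ofReal_mul zero_le_two, ENNReal.mul_rpow_of_ne_top (by finiteness)
                (by finiteness), ENNReal.ofReal_ofNat]
          _ ≤ 2 ^ a * ‖x - y‖ₑ ^ (-a) := by
              gcongr 1
              rw [ENNReal.rpow_neg, ENNReal.rpow_neg, ENNReal.inv_le_inv]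
              refine ENNReal.rpow_le_rpow ?_ ha0
              rw [← ofReal_norm]
              exact ENNReal.ofReal_le_ofReal hxy.le
      calc volume (Metric.ball c r) ^ (-1 + γ) * ∫⁻ y in Metric.ball c r, g y
          = ω ^ (-1 + γ) * ∫⁻ y in Metric.ball c r, ENNReal.ofReal r ^ (-a) * g y := by
            rw [hV, lintegral_const_mul', mul_assoc]
            exact ENNReal.rpow_ne_top_of_ne_zero (by simpa using hr) ENNReal.ofReal_ne_top
        _ ≤ ω ^ (-1 + γ) * ∫⁻ y in Metric.ball c r, 2 ^ a * (k (x - y) * g y) := by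
            gcongr 1
            refine setLIntegral_mono' Metric.isOpen_ball.measurableSet fun y hy => ?_
            rw [← mul_assoc]
            gcongr
            exact hker y hy
        _ ≤ ω ^ (-1 + γ) * ∫⁻ y in Metric.ball x₀ 3, 2 ^ a * (k (x - y) * g y) := by
            gcongr 1
            exact lintegral_mono_set hsub
        _ = _ := by
            rw [lintegral_const_mul' _ _
              (ENNReal.rpow_ne_top_of_nonneg ha0 ENNReal.ofNat_ne_top), mul_assoc]
  have hkint : ∫⁻ z, k z < ∞ := by
    rw [hk, lintegral_indicator Metric.isOpen_ball.measurableSet]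
    exact lintegral_ball_enorm_rpow_lt_top hn han 4
  calc ∫⁻ x in Metric.ball x₀ 1, fracMax γ g x
      ≤ ∫⁻ x in Metric.ball x₀ 1, (T + K * ∫⁻ y in Metric.ball x₀ 3, k (x - y) * g y) :=
        setLIntegral_mono' Metric.isOpen_ball.measurableSet hbound
    _ = T * volume (Metric.ball x₀ 1)
        + K * ∫⁻ x in Metric.ball x₀ 1, ∫⁻ y in Metric.ball x₀ 3, k (x - y) * g y := by
        rw [lintegral_add_left measurable_const, setLIntegral_const, lintegral_const_mul' _ _ hKt]
    _ = T * volume (Metric.ball x₀ 1)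
        + K * ∫⁻ y in Metric.ball x₀ 3, ∫⁻ x in Metric.ball x₀ 1, k (x - y) * g y := by
        rw [lintegral_lintegral_swap]
        refine AEMeasurable.mul (hkm.comp (measurable_fst.sub measurable_snd)).aemeasurable ?_
        exact (hgm.restrict.coe_nnreal_ennreal).comp_snd
    _ ≤ T * volume (Metric.ball x₀ 1)
        + K * ∫⁻ y in Metric.ball x₀ 3, (∫⁻ z, k z) * g y := by
        gcongr with y
        rw [lintegral_mul_const' _ _ ENNReal.coe_ne_top]
        gcongr ?_ * _
        exact (setLIntegral_le_lintegral _ _).trans (lintegral_sub_right_eq_self (μ := volume) k y).le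
    _ = T * volume (Metric.ball x₀ 1)
        + K * ((∫⁻ z, k z) * ∫⁻ y in Metric.ball x₀ 3, g y) := by
        rw [lintegral_const_mul' _ _ hkint.ne]
    _ < ∞ := by
        refine ENNReal.add_lt_top.2 ⟨ENNReal.mul_lt_top hTt.lt_top measure_ball_lt_top,
          ENNReal.mul_lt_top hKt.lt_top (ENNReal.mul_lt_top hkint (hloc _ _))⟩

/-! ### Sufficiency: boundedness from Hölder continuity -/

theorem MemOrlicz.exists_lintegral_le_one (hΦ : IsYoung Φ) {f : EuclideanSpace ℝ (Fin n) → ℝ}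
    (hf : MemOrlicz Φ f) : ∃ l : ℝ≥0, 0 < l ∧ ∫⁻ x, Φ (‖f x‖₊ / l) ≤ 1 := by
  obtain ⟨-, k, hk, hI⟩ := hf
  set I := ∫⁻ x, Φ (k * ‖f x‖₊)
  set θ : ℝ≥0 := (I.toNNReal + 1)⁻¹ with hθ
  have hθ1 : θ ≤ 1 := inv_le_one_of_one_le₀ (by simp)
  have hθ0 : 0 < θ := by positivity
  refine ⟨(θ * k)⁻¹, by positivity, ?_⟩
  calc ∫⁻ x, Φ (‖f x‖₊ / (θ * k)⁻¹) ≤ ∫⁻ x, θ * Φ (k * ‖f x‖₊) := by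
        gcongr with x
        rw [div_inv_eq_mul, show ‖f x‖₊ * (θ * k) = θ * (k * ‖f x‖₊) by ring]
        exact hΦ.map_mul_le hθ1 _
    _ = θ * I := lintegral_const_mul' _ _ ENNReal.coe_ne_top
    _ ≤ 1 := by
        rw [← ENNReal.coe_toNNReal hI.ne]
        norm_cast
        rw [hθ, inv_mul_le_iff₀ (by positivity)]
        simp

theorem weakOrliczNorm_le_of_le_fracMax (hn : 0 < n) (hΦ : IsYoungY Φ) (hΨ : IsYoung Ψ) {γ : ℝ}
    (hγ : 0 ≤ γ) {C : ℝ≥0} (hC0 : 0 < C)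
    (hC : ∀ t : ℝ≥0, 0 < t → (t : ℝ≥0∞) ^ (-γ) * youngInv Φ t ≤ C * youngInv Ψ t)
    {f : EuclideanSpace ℝ (Fin n) → ℝ} {M : EuclideanSpace ℝ (Fin n) → ℝ≥0∞} {K : ℝ≥0}
    (hK : 0 < K) (hM : ∀ x, M x ≤ K * fracMax γ (fun y => ‖f y‖₊) x) {l : ℝ≥0} (hl : 0 < l)
    (hI : ∫⁻ x, Φ (‖f x‖₊ / l) ≤ 1) :
    weakOrliczNorm Ψ M ≤ (5 ^ n * (2 * C) * K : ℝ≥0) * l := by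
  rw [← ENNReal.coe_mul]
  refine iInf₂_le _ ⟨by positivity, iSup₂_le fun t _ => ?_⟩
  -- The Vitali factor 5^n must be absorbed to reach the bound 1. Convexity gives Ψ(t) ≤ 5^{-n}
  -- Ψ(5^n t), at the price of a factor 5^n in the norm.
  have h5 : (5 ^ n : ℝ≥0)⁻¹ ≤ 1 := inv_le_one_of_one_le₀ (one_le_pow₀ (by norm_num))
  have hΨt : Ψ t ≤ (5 ^ n : ℝ≥0∞)⁻¹ * Ψ (5 ^ n * t) := by
    have := hΨ.map_mul_le h5 (5 ^ n * t)
    rw [inv_mul_cancel_left₀ (by positivity), ENNReal.coe_inv (by positivity)] at this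
    simpa using this
  have hsub : {x | (t : ℝ≥0∞) < M x / ((5 ^ n * (2 * C) * K * l : ℝ≥0) : ℝ≥0∞)} ⊆
      {x | 2 * C * ((5 ^ n * t : ℝ≥0) : ℝ≥0∞) < fracMax γ (fun y => ‖f y‖₊ / l) x} := by
    intro x hx
    simp only [mem_ofPred_eq] at hx ⊢
    rw [ENNReal.lt_div_iff_mul_lt (Or.inl (ENNReal.coe_ne_zero.2 (by positivity)))
      (Or.inl ENNReal.coe_ne_top)] at hx
    have h2 : (K * l : ℝ≥0∞) * (2 * C * ((5 ^ n * t : ℝ≥0) : ℝ≥0∞)) <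
        (K * l : ℝ≥0∞) * fracMax γ (fun y => ‖f y‖₊ / l) x :=
      calc (K * l : ℝ≥0∞) * (2 * C * ((5 ^ n * t : ℝ≥0) : ℝ≥0∞))
          = t * ((5 ^ n * (2 * C) * K * l : ℝ≥0) : ℝ≥0∞) := by push_cast; ring
        _ < M x := hx
        _ ≤ K * (l * fracMax γ (fun y => ‖f y‖₊ / l) x) :=
          (hM x).trans (by gcongr; exact fracMax_le_mul_div γ _ hl x)
        _ = _ := by ring
    exact lt_of_mul_lt_mul_left' h2
  calc Ψ t * volume {x | (t : ℝ≥0∞) < M x / ((5 ^ n * (2 * C) * K * l : ℝ≥0) : ℝ≥0∞)}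
      ≤ ((5 ^ n : ℝ≥0∞)⁻¹ * Ψ (5 ^ n * t)) *
        volume {x | 2 * C * ((5 ^ n * t : ℝ≥0) : ℝ≥0∞) < fracMax γ (fun y => ‖f y‖₊ / l) x} := by
        gcongr
    _ ≤ (5 ^ n : ℝ≥0∞)⁻¹ * 5 ^ n := by
        rw [mul_assoc]
        gcongr
        exact mul_volume_fracMax_le hn hΦ hγ hC _ hI _
    _ = 1 := ENNReal.inv_mul_cancel (by simp) (by finiteness)

/-- Sufficiency of the Lipschitz condition. -/
theorem maxCommWeakBounded_of_memLip (hn : 0 < n) {α β : ℝ} (hβ : 0 < β) (hαβ0 : 0 < α + β)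
    (hαβn : α + β < n) {b : EuclideanSpace ℝ (Fin n) → ℝ} (hΦ : IsYoungY Φ) (hΨ : IsYoung Ψ)
    (hA : InvLower ((α + β) / n) Φ Ψ) (hb : MemLip β b) : MaxCommWeakBounded b α Φ Ψ := by
  obtain ⟨b', hbb', L, hL⟩ := hb
  obtain ⟨C, hC0, hC⟩ := hA
  obtain ⟨K, hK0, hK⟩ := exists_maxComm_le_mul_fracMax hn (α := α) hβ.le hL
  have hn' : (0 : ℝ) < n := by exact_mod_cast hn
  have hγ : 0 < (α + β) / n := by positivity
  have hγ1 : (α + β) / n < 1 := (div_lt_one hn').2 hαβn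
  refine ⟨5 ^ n * (2 * C) * K, fun f hf => ?_⟩
  have hM := maxComm_congr hbb' α f
  have hle : ∀ l : ℝ≥0, 0 < l → ∫⁻ x, Φ (‖f x‖₊ / l) ≤ 1 →
      weakOrliczNorm Ψ (maxComm b α f) ≤ (5 ^ n * (2 * C) * K : ℝ≥0) * l := by
    intro l hl hI
    rw [weakOrliczNorm_congr Ψ hM]
    exact weakOrliczNorm_le_of_le_fracMax hn hΦ hΨ hγ.le hC0 hC hK0 (hK f) hl hI
  obtain ⟨l, hl, hI⟩ := hf.exists_lintegral_le_one hΦ.toIsYoung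
  refine ⟨⟨?_, (hle l hl hI).trans_lt (by finiteness)⟩, ?_⟩
  · rw [locallyIntegrable_congr hM]
    have hmeas : Measurable (maxComm b' α f) :=
      (lowerSemicontinuous_maxComm (continuous_of_abs_sub_le_rpow hβ hL) α hf.1).measurable
    intro x₀
    refine ⟨Metric.ball x₀ 1, Metric.ball_mem_nhds _ one_pos,
      hmeas.aestronglyMeasurable, ?_⟩
    have hgm : AEMeasurable fun y => ‖f y‖₊ / l :=
      hf.1.aestronglyMeasurable.aemeasurable.nnnorm.div_const l
    have hfin := lintegral_ball_fracMax_lt_top hn hΦ hΨ hγ hγ1 hC hgm hI (fun c r => by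
      have h := lintegral_enorm_ball_lt_top hf.1 c r
      refine lt_of_eq_of_lt ?_ (ENNReal.mul_lt_top (a := ((l⁻¹ : ℝ≥0) : ℝ≥0∞))
        ENNReal.coe_lt_top h)
      rw [← lintegral_const_mul' _ _ ENNReal.coe_ne_top]
      refine lintegral_congr fun y => ?_
      rw [enorm_eq_nnnorm, ← ENNReal.coe_mul, div_eq_inv_mul]) x₀
    calc ∫⁻ x in Metric.ball x₀ 1, ‖maxComm b' α f x‖ₑ
        ≤ ∫⁻ x in Metric.ball x₀ 1, K * (l * fracMax ((α + β) / n) (fun y => ‖f y‖₊ / l) x) := by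
          gcongr with x
          rw [enorm_eq_self]
          refine (hK f x).trans ?_
          gcongr
          exact fracMax_le_mul_div _ _ hl x
      _ = K * (l * ∫⁻ x in Metric.ball x₀ 1, fracMax ((α + β) / n) (fun y => ‖f y‖₊ / l) x) := by
          rw [lintegral_const_mul' _ _ ENNReal.coe_ne_top,
            lintegral_const_mul' _ _ ENNReal.coe_ne_top]
      _ < ∞ := ENNReal.mul_lt_top ENNReal.coe_lt_top (ENNReal.mul_lt_top ENNReal.coe_lt_top hfin)
  · have hD : ((5 ^ n * (2 * C) * K : ℝ≥0) : ℝ≥0∞) ≠ 0 := ENNReal.coe_ne_zero.2 (by positivity)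
    rw [← ENNReal.div_le_iff' hD ENNReal.coe_ne_top]
    refine le_iInf₂ fun l h => ?_
    rw [ENNReal.div_le_iff' hD ENNReal.coe_ne_top]
    exact hle l h.1 h.2

/-! ### Necessity: testing on indicators of balls -/

theorem lintegral_comp_indicator_ball (h0 : Φ 0 = 0) (c : EuclideanSpace ℝ (Fin n)) (r : ℝ)
    (k : ℝ≥0) :
    ∫⁻ x, Φ (k * ‖(Metric.ball c r).indicator (1 : EuclideanSpace ℝ (Fin n) → ℝ) x‖₊)
      = Φ k * volume (Metric.ball c r) := by
  rw [← lintegral_indicator_const Metric.isOpen_ball.measurableSet]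
  congr 1
  ext x
  by_cases hx : x ∈ Metric.ball c r <;> simp [hx, h0]

theorem memOrlicz_indicator_ball (hΦ : IsYoungY Φ) (c : EuclideanSpace ℝ (Fin n)) (r : ℝ) :
    MemOrlicz Φ ((Metric.ball c r).indicator (1 : EuclideanSpace ℝ (Fin n) → ℝ)) := by
  refine ⟨(locallyIntegrable_const (1 : ℝ)).indicator Metric.isOpen_ball.measurableSet,
    1, one_pos, ?_⟩
  rw [lintegral_comp_indicator_ball hΦ.map_zero]
  exact ENNReal.mul_lt_top (hΦ.lt_top 1 one_pos) measure_ball_lt_top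

theorem orliczNorm_indicator_ball_le (h0 : Φ 0 = 0) (c : EuclideanSpace ℝ (Fin n)) (r : ℝ)
    {k : ℝ≥0} (hk : 0 < k) (h : Φ k * volume (Metric.ball c r) ≤ 1) :
    orliczNorm Φ ((Metric.ball c r).indicator (1 : EuclideanSpace ℝ (Fin n) → ℝ))
      ≤ (k⁻¹ : ℝ≥0) := by
  refine iInf₂_le _ ⟨by positivity, ?_⟩
  rw [← lintegral_comp_indicator_ball h0] at h
  simpa only [div_inv_eq_mul, mul_comm] using h

/-- Layer-cake formula split at height T. Below T the trivial bound μ(X) suffices; above T the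
almost decreasing quotient gives μ{u > t} ≤ 1/Ψ(t) ≤ D μ(X) (T/t)^{1+ε}, which is integrable at
infinity because ε > 0. -/
theorem lintegral_ofReal_le_of_weak {X : Type*} [MeasurableSpace X] (μ : Measure X)
    (hμ : μ univ ≠ ∞) {ε : ℝ} (hε : 0 < ε) {D : ℝ≥0}
    (hD : ∀ s t : ℝ≥0, 0 < s → s ≤ t →
      (t : ℝ≥0∞) ^ (1 + ε) / Ψ t ≤ D * ((s : ℝ≥0∞) ^ (1 + ε) / Ψ s))
    {u : X → ℝ} (hu0 : 0 ≤ u) (hu : AEMeasurable u μ)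
    (hw : ∀ t : ℝ≥0, 0 < t → Ψ t * μ {x | t < u x} ≤ 1) {T : ℝ≥0} (hT : 0 < T)
    (hΨT : (μ univ)⁻¹ ≤ Ψ T) :
    ∫⁻ x, ENNReal.ofReal (u x) ∂μ ≤ (1 + D * ENNReal.ofReal ε⁻¹) * μ univ * T := by
  have hT' : (0 : ℝ) < T := hT
  have htail : ∀ t ∈ Ioi (T : ℝ), μ {x | t < u x} ≤
      D * μ univ * (T : ℝ≥0∞) ^ (1 + ε) * ENNReal.ofReal (t ^ (-(1 + ε))) := by
    intro t ht
    have ht0 : 0 < t := hT'.trans ht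
    lift t to ℝ≥0 using ht0.le
    have ht0' : 0 < t := ht0
    have hp0 : (t : ℝ≥0∞) ^ (1 + ε) ≠ 0 := by simp [ENNReal.rpow_eq_zero_iff, ht0'.ne']
    have hpt : (t : ℝ≥0∞) ^ (1 + ε) ≠ ∞ :=
      ENNReal.rpow_ne_top_of_nonneg (by positivity) ENNReal.coe_ne_top
    have h1 : μ {x | (t : ℝ) < u x} ≤ (Ψ t)⁻¹ := by
      rw [ENNReal.le_inv_iff_mul_le, mul_comm]
      exact hw t ht0
    have h2 := hD T t hT (by exact_mod_cast (le_of_lt ht))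
    calc μ {x | (t : ℝ) < u x} ≤ (Ψ t)⁻¹ := h1
      _ = ((t : ℝ≥0∞) ^ (1 + ε))⁻¹ * ((t : ℝ≥0∞) ^ (1 + ε) / Ψ t) := by
          rw [div_eq_mul_inv, ← mul_assoc, ENNReal.inv_mul_cancel hp0 hpt, one_mul]
      _ ≤ ((t : ℝ≥0∞) ^ (1 + ε))⁻¹ * (D * ((T : ℝ≥0∞) ^ (1 + ε) * μ univ)) := by
          gcongr
          refine h2.trans ?_
          rw [div_eq_mul_inv]
          gcongr
          exact ENNReal.inv_le_iff_inv_le.1 hΨT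
      _ = _ := by
          rw [← ENNReal.rpow_neg, ← ENNReal.ofReal_rpow_of_pos ht0, ENNReal.ofReal_coe_nnreal]
          ring
  have hint : ∫⁻ t in Ioi (T : ℝ), ENNReal.ofReal (t ^ (-(1 + ε)))
      = ENNReal.ofReal ((T : ℝ) ^ (-ε) * ε⁻¹) := by
    rw [← ofReal_integral_eq_lintegral_ofReal (integrableOn_Ioi_rpow_of_lt (by linarith) hT'),
      integral_Ioi_rpow_of_lt (by linarith) hT']
    · congr 1
      rw [show -(1 + ε) + 1 = -ε by ring, neg_div_neg_eq, div_eq_mul_inv]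
    · filter_upwards [ae_restrict_mem measurableSet_Ioi] with t ht
      have : 0 < t := hT'.trans ht
      positivity
  have hT0 : (T : ℝ≥0∞) ≠ 0 := ENNReal.coe_ne_zero.2 hT.ne'
  rw [lintegral_eq_lintegral_meas_lt μ (ae_of_all _ hu0) hu, ← Ioc_union_Ioi_eq_Ioi hT'.le]
  refine (lintegral_union_le _ _ _).trans ?_
  calc (∫⁻ t in Ioc 0 (T : ℝ), μ {x | t < u x}) + ∫⁻ t in Ioi (T : ℝ), μ {x | t < u x}
      ≤ (∫⁻ t in Ioc 0 (T : ℝ), μ univ) + ∫⁻ t in Ioi (T : ℝ),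
          D * μ univ * (T : ℝ≥0∞) ^ (1 + ε) * ENNReal.ofReal (t ^ (-(1 + ε))) := by
        refine add_le_add (lintegral_mono fun t => measure_mono (subset_univ _)) ?_
        exact setLIntegral_mono' measurableSet_Ioi htail
    _ = μ univ * T + D * μ univ * (T : ℝ≥0∞) ^ (1 + ε) *
          ENNReal.ofReal ((T : ℝ) ^ (-ε) * ε⁻¹) := by
        rw [setLIntegral_const, Real.volume_Ioc, sub_zero, ENNReal.ofReal_coe_nnreal,
          lintegral_const_mul', hint]
        refine ENNReal.mul_ne_top (ENNReal.mul_ne_top ENNReal.coe_ne_top hμ) ?_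
        exact ENNReal.rpow_ne_top_of_nonneg (by positivity) ENNReal.coe_ne_top
    _ = μ univ * T + D * μ univ * ((T : ℝ≥0∞) ^ (1 + ε) * (T : ℝ≥0∞) ^ (-ε)) *
          ENNReal.ofReal ε⁻¹ := by
        rw [ENNReal.ofReal_mul (by positivity), ← ENNReal.ofReal_rpow_of_pos hT',
          ENNReal.ofReal_coe_nnreal]
        ring
    _ = _ := by
        rw [← ENNReal.rpow_add _ _ hT0 ENNReal.coe_ne_top, add_neg_cancel_right, ENNReal.rpow_one]
        ring

theorem enorm_sub_average_le {X : Type*} [MeasurableSpace X] (μ : Measure X) (hμ0 : μ univ ≠ 0)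
    (hμ : μ univ ≠ ∞) {b : X → ℝ} (hb : Integrable b μ) (a : ℝ) :
    ‖a - ⨍ y, b y ∂μ‖ₑ ≤ (μ univ)⁻¹ * ∫⁻ y, ‖a - b y‖ₑ ∂μ := by
  have : IsFiniteMeasure μ := ⟨hμ.lt_top⟩
  have : NeZero μ := ⟨fun h => hμ0 (by simp [h])⟩
  have h : a - ⨍ y, b y ∂μ = ⨍ y, (a - b y) ∂μ := by
    rw [average, average, integral_sub (integrable_const _) hb.to_average]
    simp
  rw [h, average]
  refine (enorm_integral_le_lintegral_enorm _).trans ?_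
  rw [lintegral_smul_measure, smul_eq_mul]

theorem integrableOn_ball_of_locallyIntegrable {b : EuclideanSpace ℝ (Fin n) → ℝ}
    (hb : LocallyIntegrable b volume) (c : EuclideanSpace ℝ (Fin n)) (r : ℝ) :
    IntegrableOn b (Metric.ball c r) :=
  (hb.integrableOn_isCompact (isCompact_closedBall c r)).mono_set Metric.ball_subset_closedBall

/-- With p = Φ⁻¹(1/|B|), the weak norm of the image of the indicator of B is at most a multiple of
1/p, while (B) provides a splitting height T comparable to p |B|^{(α+β)/n}. The factors p cancel, so
no trace of Φ and Ψ survives in the power of |B|. -/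
theorem exists_lintegral_oscillation_le {α β : ℝ}
    {b : EuclideanSpace ℝ (Fin n) → ℝ} (hb : LocallyIntegrable b volume) (hΦ : IsYoungY Φ)
    (hΨ : IsYoung Ψ) (hB : InvUpper ((α + β) / n) Φ Ψ) {ε : ℝ} (hε : 0 < ε)
    (hdec : AlmostDecreasing (fun t => (t : ℝ≥0∞) ^ (1 + ε) / Ψ t))
    (hbd : MaxCommWeakBounded b α Φ Ψ) :
    ∃ A : ℝ≥0∞, A ≠ ∞ ∧ ∀ c r, 0 < r →
      ∫⁻ x in Metric.ball c r, ‖b x - ⨍ y in Metric.ball c r, b y‖ₑ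
        ≤ A * volume (Metric.ball c r) ^ (1 + β / n) := by
  obtain ⟨C₂, hC₂0, hC₂⟩ := hB
  obtain ⟨D, -, hD⟩ := hdec
  obtain ⟨C₀, hC₀⟩ := hbd
  refine ⟨(2 * C₀ + 1) * (1 + D * ENNReal.ofReal ε⁻¹) * (2 * C₂), by finiteness, fun c r hr => ?_⟩
  set B := Metric.ball c r
  set V := volume B with hV
  have hV0 : V ≠ 0 := (Metric.measure_ball_pos _ _ hr).ne'
  have hVt : V ≠ ∞ := measure_ball_lt_top.ne
  have hVi0 : 0 < V⁻¹ := ENNReal.inv_pos.2 hVt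
  have hVit : V⁻¹ ≠ ∞ := ENNReal.inv_ne_top.2 hV0
  obtain ⟨p, hp⟩ : ∃ p : ℝ≥0, (p : ℝ≥0∞) = youngInv Φ V⁻¹ :=
    ⟨_, ENNReal.coe_toNNReal (hΦ.youngInv_lt_top hVit).ne⟩
  have hp0 : 0 < p := ENNReal.coe_pos.1 (hp ▸ hΦ.youngInv_pos hVi0)
  have hΦp : Φ (p / 2) * volume B ≤ 1 := by
    rw [← hV, ← ENNReal.le_inv_iff_mul_le]
    refine map_le_of_lt_youngInv ?_
    rw [← hp]
    exact_mod_cast NNReal.half_lt_self hp0.ne'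
  obtain ⟨-, hMnorm⟩ := hC₀ _ (memOrlicz_indicator_ball hΦ c r)
  set M := maxComm b α (B.indicator (1 : EuclideanSpace ℝ (Fin n) → ℝ)) with hM
  -- The norm is at most 2 C₀ / p, since p/2 lies strictly below Φ⁻¹(1/|B|). The extra 1 makes the
  -- inequality strict, so an admissible l below this value can be extracted from the infimum.
  have hlt : weakOrliczNorm Ψ M < ((2 * C₀ + 1) / p : ℝ≥0) := by
    refine (hMnorm.trans (mul_le_mul_right
      (orliczNorm_indicator_ball_le hΦ.map_zero c r (half_pos hp0) hΦp) _)).trans_lt ?_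
    rw [← ENNReal.coe_mul, ENNReal.coe_lt_coe, lt_div_iff₀ hp0, inv_div, mul_assoc,
      div_mul_cancel₀ _ hp0.ne', mul_comm]
    exact lt_add_one _
  simp only [weakOrliczNorm, iInf_lt_iff] at hlt
  obtain ⟨l, ⟨hl0, hl⟩, hlt⟩ := hlt
  have hVγ : V ^ ((α + β) / n) ≠ ∞ := ENNReal.rpow_ne_top_of_ne_zero hV0 hVt
  have hVγ0 : V ^ ((α + β) / n) ≠ 0 := (ENNReal.rpow_pos (pos_iff_ne_zero.2 hV0) hVt).ne'
  have hVα : V ^ (α / n) ≠ ∞ := ENNReal.rpow_ne_top_of_ne_zero hV0 hVt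
  obtain ⟨v, hv⟩ : ∃ v : ℝ≥0, (v : ℝ≥0∞) = V ^ ((α + β) / n) := ⟨_, ENNReal.coe_toNNReal hVγ⟩
  obtain ⟨w, hw⟩ : ∃ w : ℝ≥0, (w : ℝ≥0∞) = V ^ (α / n) := ⟨_, ENNReal.coe_toNNReal hVα⟩
  have hv0 : 0 < v := by
    rw [← hv] at hVγ0
    exact pos_iff_ne_zero.2 (ENNReal.coe_ne_zero.1 hVγ0)
  -- Twice the bound that (B) gives for Ψ⁻¹(1/|B|): strictly exceeding this inverse forces Ψ(T) >
  -- 1/|B|.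
  set T : ℝ≥0 := 2 * C₂ * p * v with hT
  have hT0 : 0 < T := by positivity
  have hΨT : V⁻¹ < Ψ T := by
    refine hΨ.lt_map_of_youngInv_lt ?_
    have h := hC₂ V⁻¹.toNNReal (ENNReal.toNNReal_pos hVi0.ne' hVit)
    rw [ENNReal.coe_toNNReal hVit, ← hp, ENNReal.rpow_neg, ENNReal.inv_rpow, inv_inv, ← hv] at h
    refine h.trans_lt ?_
    rw [hT]
    norm_cast
    have : 0 < C₂ * (p * v) := by positivity
    calc C₂ * (p * v) < C₂ * (p * v) + C₂ * (p * v) := lt_add_of_pos_left _ this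
      _ = 2 * C₂ * p * v := by ring
  set m := ⨍ y in B, b y with hm
  have hlow : ∀ x ∈ B, (w : ℝ≥0∞) * ‖b x - m‖ₑ ≤ M x := by
    intro x hx
    have h1 := enorm_sub_average_le (volume.restrict B) (by simpa using hV0) (by simpa using hVt)
      (integrableOn_ball_of_locallyIntegrable hb c r) (b x)
    rw [Measure.restrict_apply_univ, ← hm, ← hV] at h1
    refine le_trans ?_ (le_iSup₂_of_le c r (le_iSup_of_le ⟨hr, hx⟩ le_rfl))
    calc (w : ℝ≥0∞) * ‖b x - m‖ₑ ≤ V ^ (α / n) * (V⁻¹ * ∫⁻ y in B, ‖b x - b y‖ₑ) := by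
          rw [hw]; gcongr
      _ = V ^ (-1 + α / n) * ∫⁻ y in B, ‖b x - b y‖ₑ := by
          rw [add_comm, ENNReal.rpow_add _ _ hV0 hVt, ENNReal.rpow_neg_one, mul_assoc]
      _ = _ := by
          congr 1
          refine setLIntegral_congr_fun Metric.isOpen_ball.measurableSet fun y hy => ?_
          rw [indicator_of_mem hy]
          simp
  set u : EuclideanSpace ℝ (Fin n) → ℝ := fun x => w * |b x - m| / l with hu
  have huE : ∀ x, ENNReal.ofReal (u x) = w * ‖b x - m‖ₑ / l := by
    intro x
    rw [hu, ENNReal.ofReal_div_of_pos (by exact_mod_cast hl0), ENNReal.ofReal_mul (by positivity),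
      ENNReal.ofReal_coe_nnreal, ENNReal.ofReal_coe_nnreal, Real.enorm_eq_ofReal_abs]
  have hweak : ∀ t : ℝ≥0, 0 < t → Ψ t * volume.restrict B {x | t < u x} ≤ 1 := by
    intro t ht
    refine le_trans ?_ ((le_iSup₂ (f := fun (t : ℝ≥0) (_ : 0 < t) =>
      Ψ t * volume {x | (t : ℝ≥0∞) < M x / l}) t ht).trans hl)
    refine mul_le_mul_right ?_ _
    rw [Measure.restrict_apply' Metric.isOpen_ball.measurableSet]
    refine measure_mono fun x hx => ?_
    have h1 : ENNReal.ofReal (t : ℝ) < ENNReal.ofReal (u x) :=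
      (ENNReal.ofReal_lt_ofReal_iff (lt_of_le_of_lt t.2 hx.1)).2 hx.1
    rw [ENNReal.ofReal_coe_nnreal, huE] at h1
    refine h1.trans_le ?_
    gcongr
    exact hlow x hx.2
  have hmeas : AEMeasurable u (volume.restrict B) := by
    have := hb.aestronglyMeasurable.aemeasurable.restrict (s := B)
    have h2 : AEMeasurable (fun x => |b x - m|) (volume.restrict B) := by
      simpa only [Real.norm_eq_abs] using (this.sub_const m).norm
    exact (h2.const_mul _).div_const _
  have key := lintegral_ofReal_le_of_weak (volume.restrict B)
    (by simpa using hVt) hε hD (fun x => by positivity) hmeas hweak hT0 (by simpa using hΨT.le)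
  simp only [huE, Measure.restrict_apply_univ, ← hV] at key
  have hl0' : (l : ℝ≥0∞) ≠ 0 := ENNReal.coe_ne_zero.2 hl0.ne'
  have hw0 : (w : ℝ≥0∞) ≠ 0 := by
    rw [hw]; exact (ENNReal.rpow_pos (pos_iff_ne_zero.2 hV0) hVt).ne'
  have hwv : (w : ℝ≥0∞)⁻¹ * v = V ^ (β / n) := by
    rw [hw, hv, ← ENNReal.rpow_neg, ← ENNReal.rpow_add _ _ hV0 hVt]
    congr 1; ring
  have hp0' : (p : ℝ≥0∞) ≠ 0 := ENNReal.coe_ne_zero.2 hp0.ne'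
  calc ∫⁻ x in B, ‖b x - m‖ₑ = (l / w) * ∫⁻ x in B, w * ‖b x - m‖ₑ / l := by
        rw [← lintegral_const_mul' _ _ (ENNReal.div_ne_top ENNReal.coe_ne_top hw0)]
        refine lintegral_congr fun x => ?_
        calc ‖b x - m‖ₑ = (l * (l : ℝ≥0∞)⁻¹) * ((w : ℝ≥0∞)⁻¹ * w) * ‖b x - m‖ₑ := by
              rw [ENNReal.mul_inv_cancel hl0' ENNReal.coe_ne_top,
                ENNReal.inv_mul_cancel hw0 ENNReal.coe_ne_top, one_mul, one_mul]
          _ = _ := by simp only [div_eq_mul_inv]; ring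
    _ ≤ (((2 * C₀ + 1) / p : ℝ≥0) / w) * ((1 + D * ENNReal.ofReal ε⁻¹) * V * T) := by
        gcongr
    _ = (2 * C₀ + 1) * (1 + D * ENNReal.ofReal ε⁻¹) * (2 * C₂) *
          ((p : ℝ≥0∞)⁻¹ * p) * (V * ((w : ℝ≥0∞)⁻¹ * v)) := by
        rw [hT, ENNReal.coe_div hp0.ne']
        push_cast
        simp only [div_eq_mul_inv]
        ring
    _ = _ := by
        rw [ENNReal.inv_mul_cancel hp0' ENNReal.coe_ne_top, hwv, mul_one,
          ENNReal.rpow_add _ _ hV0 hVt, ENNReal.rpow_one]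

/-! ### From mean oscillation to Hölder continuity -/

/-- McShane-type extension of Hölder functions. -/
theorem exists_holder_extension {E : Type*} [NormedAddCommGroup E] {S : Set E} (hS : S.Nonempty)
    {b : E → ℝ} {β C : ℝ} (hβ0 : 0 < β) (hβ1 : β ≤ 1) (hC : 0 ≤ C)
    (hb : ∀ x ∈ S, ∀ y ∈ S, |b x - b y| ≤ C * ‖x - y‖ ^ β) :
    ∃ b' : E → ℝ, (∀ x ∈ S, b x = b' x) ∧ ∀ x y, |b' x - b' y| ≤ C * ‖x - y‖ ^ β := by
  have htri : ∀ x y z : E, C * ‖x - z‖ ^ β ≤ C * ‖x - y‖ ^ β + C * ‖y - z‖ ^ β := by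
    intro x y z
    rw [← mul_add]
    gcongr
    calc ‖x - z‖ ^ β ≤ (‖x - y‖ + ‖y - z‖) ^ β := by
          gcongr; exact norm_sub_le_norm_sub_add_norm_sub x y z
      _ ≤ _ := Real.rpow_add_le_add_rpow (norm_nonneg _) (norm_nonneg _) hβ0.le hβ1
  obtain ⟨y₀, hy₀⟩ := hS
  have : Nonempty S := ⟨⟨y₀, hy₀⟩⟩
  have hbdd : ∀ x, BddBelow (range fun y : S => b y + C * ‖x - (y : E)‖ ^ β) := by
    intro x
    refine ⟨b y₀ - C * ‖y₀ - x‖ ^ β, ?_⟩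
    rintro _ ⟨y, rfl⟩
    have h1 := (abs_le.1 (hb y₀ hy₀ y y.2)).2
    have h2 := htri y₀ x y
    dsimp only
    linarith
  have hle : ∀ x y, (⨅ z : S, b z + C * ‖x - (z : E)‖ ^ β) ≤
      (⨅ z : S, b z + C * ‖y - (z : E)‖ ^ β) + C * ‖x - y‖ ^ β := by
    intro x y
    rw [← sub_le_iff_le_add]
    refine le_ciInf fun z => ?_
    have h1 := ciInf_le (hbdd x) z
    have h2 := htri x y z
    linarith
  refine ⟨fun x => ⨅ z : S, b z + C * ‖x - (z : E)‖ ^ β, fun x hx => le_antisymm ?_ ?_, fun x y => ?_⟩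
  · refine le_ciInf fun z => ?_
    have := (abs_le.1 (hb x hx z z.2)).2
    linarith
  · refine (ciInf_le (hbdd x) ⟨x, hx⟩).trans ?_
    simp [Real.zero_rpow hβ0.ne']
  · have h1 := hle x y
    have h2 := hle y x
    rw [norm_sub_rev y x] at h2
    rw [abs_le]
    constructor <;> linarith

/-- Lebesgue differentiation is applied to closed balls and transferred to open ones because spheres
are null. -/
theorem ae_tendsto_average_ball (hn : 0 < n) {b : EuclideanSpace ℝ (Fin n) → ℝ}
    (hb : LocallyIntegrable b volume) : ∀ᵐ x, ∀ δ : ℕ → ℝ, Tendsto δ atTop (𝓝[>] 0) →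
      Tendsto (fun k => ⨍ y in Metric.ball x (δ k), b y) atTop (𝓝 (b x)) := by
  have : Nonempty (Fin n) := ⟨⟨0, hn⟩⟩
  filter_upwards [IsUnifLocDoublingMeasure.ae_tendsto_average volume hb 1] with x hx δ hδ
  have h := hx (fun _ => x) δ hδ (by
    filter_upwards [hδ self_mem_nhdsWithin] with k hk
    exact Metric.mem_closedBall_self (by simpa using le_of_lt hk))
  refine h.congr fun k => ?_
  have hae : (Metric.closedBall x (δ k) : Set _) =ᵐ[volume] Metric.ball x (δ k) :=
    (ae_eq_of_subset_of_measure_ge Metric.ball_subset_closedBall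
      (Measure.addHaar_closedBall_eq_addHaar_ball volume x (δ k)).le
      Metric.isOpen_ball.measurableSet.nullMeasurableSet measure_closedBall_lt_top.ne).symm
  exact setAverage_congr hae

/-- Campanato's characterization of Hölder continuity. -/
theorem memLip_of_lintegral_oscillation_le (hn : 0 < n) {β : ℝ} (hβ0 : 0 < β) (hβ1 : β ≤ 1)
    {b : EuclideanSpace ℝ (Fin n) → ℝ} (hb : LocallyIntegrable b volume) {A : ℝ≥0∞} (hA : A ≠ ∞)
    (hosc : ∀ c r, 0 < r → ∫⁻ x in Metric.ball c r, ‖b x - ⨍ y in Metric.ball c r, b y‖ₑ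
        ≤ A * volume (Metric.ball c r) ^ (1 + β / n)) : MemLip β b := by
  set ω := volume (Metric.ball (0 : EuclideanSpace ℝ (Fin n)) 1) with hω
  have hω0 : ω ≠ 0 := (Metric.measure_ball_pos _ _ one_pos).ne'
  have hωt : ω ≠ ∞ := measure_ball_lt_top.ne
  have hn' : (0 : ℝ) < n := by exact_mod_cast hn
  have hβn : 0 ≤ β / n := by positivity
  set m : EuclideanSpace ℝ (Fin n) → ℝ → ℝ := fun c r => ⨍ y in Metric.ball c r, b y with hm
  set A' : ℝ≥0∞ := A * (2 ^ n * (ω ^ (β / n) * 2 ^ β)) with hA'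
  have hA't : A' ≠ ∞ := by
    have h1 : ω ^ (β / n) ≠ ∞ := ENNReal.rpow_ne_top_of_nonneg hβn hωt
    have h2 : (2 : ℝ≥0∞) ^ β ≠ ∞ := ENNReal.rpow_ne_top_of_nonneg hβ0.le ENNReal.ofNat_ne_top
    finiteness
  -- One comparison serves twice: c' = c gives the dyadic telescoping, and dist c' c = s links the
  -- means around two different points.
  have hstep : ∀ c c' s, 0 < s → dist c' c ≤ s → |m c' s - m c (2 * s)| ≤ A'.toReal * s ^ β := by
    intro c c' s hs hcc
    have hsub : Metric.ball c' s ⊆ Metric.ball c (2 * s) :=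
      Metric.ball_subset_ball' (by linarith)
    have hV0 : volume (Metric.ball c' s) ≠ 0 := (Metric.measure_ball_pos _ _ hs).ne'
    have hVt : volume (Metric.ball c' s) ≠ ∞ := measure_ball_lt_top.ne
    have hW : volume (Metric.ball c (2 * s)) = 2 ^ n * volume (Metric.ball c' s) := by
      rw [volume_ball_mul _ two_pos hs, ENNReal.ofReal_ofNat, volume_ball_eq c hs,
        volume_ball_eq c' hs]
    have hW0 : volume (Metric.ball c (2 * s)) ≠ 0 := (Metric.measure_ball_pos _ _ (by positivity)).ne'
    have hWt : volume (Metric.ball c (2 * s)) ≠ ∞ := measure_ball_lt_top.ne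
    have hWβ : volume (Metric.ball c (2 * s)) ^ (β / n)
        = ω ^ (β / n) * (2 ^ β * ENNReal.ofReal s ^ β) := by
      have h := ofReal_rpow_eq_volume_ball hn c (r := 2 * s) (by positivity) β
      rw [ENNReal.div_rpow_of_nonneg _ _ hβn, ENNReal.ofReal_mul zero_le_two,
        ENNReal.mul_rpow_of_nonneg _ _ hβ0.le, ENNReal.ofReal_ofNat] at h
      rw [h, ← hω, ENNReal.mul_div_cancel]
      · exact (ENNReal.rpow_pos (pos_iff_ne_zero.2 hω0) hωt).ne'
      · exact ENNReal.rpow_ne_top_of_nonneg hβn hωt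
    have hE : ‖m c (2 * s) - m c' s‖ₑ ≤ A' * ENNReal.ofReal s ^ β := by
      have h1 := enorm_sub_average_le (volume.restrict (Metric.ball c' s)) (by simpa using hV0) (by simpa using hVt)
        (integrableOn_ball_of_locallyIntegrable hb c' s) (m c (2 * s))
      rw [Measure.restrict_apply_univ] at h1
      calc ‖m c (2 * s) - m c' s‖ₑ
          ≤ (volume (Metric.ball c' s))⁻¹ *
            ∫⁻ y in Metric.ball c' s, ‖m c (2 * s) - b y‖ₑ := h1
        _ ≤ (volume (Metric.ball c' s))⁻¹ *
            ∫⁻ y in Metric.ball c (2 * s), ‖b y - m c (2 * s)‖ₑ := by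
            gcongr 1
            refine (lintegral_mono_set hsub).trans (lintegral_mono fun y => ?_)
            rw [enorm_sub_rev]
        _ ≤ (volume (Metric.ball c' s))⁻¹ *
            (A * volume (Metric.ball c (2 * s)) ^ (1 + β / n)) := by
            gcongr
            exact hosc c (2 * s) (by positivity)
        _ = ((volume (Metric.ball c' s))⁻¹ * volume (Metric.ball c' s)) *
            (A' * ENNReal.ofReal s ^ β) := by
            rw [ENNReal.rpow_add _ _ hW0 hWt, ENNReal.rpow_one, hWβ, hW, hA']
            ring
        _ = _ := by rw [ENNReal.inv_mul_cancel hV0 hVt, one_mul]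
    rw [abs_sub_comm]
    have h3 : A' * ENNReal.ofReal s ^ β ≠ ∞ :=
      ENNReal.mul_ne_top hA't (ENNReal.rpow_ne_top_of_nonneg hβ0.le ENNReal.ofReal_ne_top)
    have h4 := ENNReal.toReal_mono h3 hE
    rwa [toReal_enorm, Real.norm_eq_abs, ENNReal.toReal_mul, ← ENNReal.toReal_rpow,
      ENNReal.toReal_ofReal hs.le] at h4
  set q : ℝ := (1 / 2) ^ β with hq
  have hq0 : 0 ≤ q := by positivity
  have hq1 : q < 1 := Real.rpow_lt_one (by norm_num) (by norm_num) hβ0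
  obtain ⟨S, hSae, hS⟩ := (ae_tendsto_average_ball hn hb).exists_mem
  -- The means over radii s/2^k converge to b(x) at points of S, and consecutive differences decay
  -- geometrically with ratio q = 2^{-β} < 1.
  have hpoint : ∀ x ∈ S, ∀ s, 0 < s → |m x s - b x| ≤ A'.toReal * s ^ β / (1 - q) := by
    intro x hx s hs
    have hδ : Tendsto (fun k : ℕ => s * (1 / 2 : ℝ) ^ k) atTop (𝓝[>] 0) := by
      refine tendsto_nhdsWithin_iff.2 ⟨?_, Eventually.of_forall fun k => ?_⟩
      · simpa using (tendsto_pow_atTop_nhds_zero_of_lt_one (r := (1 / 2 : ℝ)) (by norm_num)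
          (by norm_num)).const_mul s
      · exact mem_Ioi.2 (by positivity)
    have h := dist_le_of_le_geometric_of_tendsto₀ q (A'.toReal * s ^ β) hq1 (fun k => ?_)
      (hS x hx _ hδ)
    · simpa [Real.dist_eq] using h
    · have h1 := hstep x x (s * (1 / 2) ^ (k + 1)) (by positivity) (by simpa using by positivity)
      rw [show 2 * (s * (1 / 2 : ℝ) ^ (k + 1)) = s * (1 / 2) ^ k by rw [pow_succ]; ring] at h1
      rw [Real.dist_eq, abs_sub_comm]
      refine h1.trans ?_
      rw [mul_assoc]
      gcongr
      rw [Real.mul_rpow hs.le (by positivity), ← Real.rpow_natCast, ← Real.rpow_mul (by norm_num),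
        mul_comm _ β, Real.rpow_mul (by norm_num), Real.rpow_natCast]
      gcongr 1
      exact pow_le_pow_of_le_one hq0 hq1.le (Nat.le_succ k)
  have hSne : S.Nonempty := by
    by_contra h
    rw [not_nonempty_iff_eq_empty] at h
    rw [h, empty_mem_iff_bot] at hSae
    exact (NeZero.ne (volume : Measure (EuclideanSpace ℝ (Fin n)))) (ae_eq_bot.1 hSae)
  have h1q : 0 < 1 - q := by linarith
  obtain ⟨b', hbb', hb'⟩ := exists_holder_extension hSne (b := b) hβ0 hβ1
    (C := 2 * (A'.toReal / (1 - q)) + 2 * A'.toReal)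
    (by positivity) (fun x hx y hy => by
      rcases eq_or_ne x y with rfl | hxy
      · simp [Real.zero_rpow hβ0.ne']
      have hs : 0 < ‖x - y‖ := norm_pos_iff.2 (sub_ne_zero.2 hxy)
      -- With s = |x - y|, the chain is b(x), mean on B(x,s), mean on B(x,2s), mean on B(y,s), b(y).
      -- The two outer links cost A' s^β/(1-q) each, the two inner ones A' s^β each.
      have h1 := abs_le.1 (hpoint x hx _ hs)
      have h2 := abs_le.1 (hpoint y hy _ hs)
      have h3 := abs_le.1 (hstep x x _ hs (by simp))
      have h4 := abs_le.1 (hstep x y _ hs (by rw [dist_comm, dist_eq_norm]))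
      rw [show (2 * (A'.toReal / (1 - q)) + 2 * A'.toReal) * ‖x - y‖ ^ β =
        2 * (A'.toReal * ‖x - y‖ ^ β / (1 - q)) + 2 * (A'.toReal * ‖x - y‖ ^ β) by ring]
      rw [abs_le]
      constructor <;> linarith)
  exact ⟨b', by filter_upwards [hSae] with x hx using hbb' x hx, _, hb'⟩

end OrliczComm

theorem mainTheorem3 (n : ℕ) (α β : ℝ) (hβ0 : 0 < β) (hβ1 : β < 1) (hα0 : 0 ≤ α) (hαn : α < n)
    (hαβ0 : 0 < α + β) (hαβn : α + β < n)
    (b : EuclideanSpace ℝ (Fin n) → ℝ) (hb : LocallyIntegrable b volume)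
    (Φ Ψ : ℝ≥0 → ℝ≥0∞) (hΦ : OrliczComm.IsYoungY Φ) (hΨ : OrliczComm.IsYoung Ψ) :
    (OrliczComm.InvLower ((α + β) / n) Φ Ψ →
      OrliczComm.MemLip β b → OrliczComm.MaxCommWeakBounded b α Φ Ψ) ∧
    (OrliczComm.InvUpper ((α + β) / n) Φ Ψ →
      (∃ ε : ℝ, 0 < ε ∧
        OrliczComm.AlmostDecreasing (fun t => (t : ℝ≥0∞) ^ (1 + ε) / Ψ t)) →
      OrliczComm.MaxCommWeakBounded b α Φ Ψ → OrliczComm.MemLip β b) ∧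
    (OrliczComm.InvLower ((α + β) / n) Φ Ψ → OrliczComm.InvUpper ((α + β) / n) Φ Ψ →
      (∃ ε : ℝ, 0 < ε ∧
        OrliczComm.AlmostDecreasing (fun t => (t : ℝ≥0∞) ^ (1 + ε) / Ψ t)) →
      (OrliczComm.MemLip β b ↔ OrliczComm.MaxCommWeakBounded b α Φ Ψ)) := by
  have hn : 0 < n := by
    have : (0 : ℝ) < n := hα0.trans_lt hαn
    exact_mod_cast this
  have suff := fun hA => OrliczComm.maxCommWeakBounded_of_memLip (b := b) hn hβ0 hαβ0 hαβn hΦ hΨ hA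
  have nec : OrliczComm.InvUpper ((α + β) / n) Φ Ψ →
      (∃ ε : ℝ, 0 < ε ∧
        OrliczComm.AlmostDecreasing (fun t => (t : ℝ≥0∞) ^ (1 + ε) / Ψ t)) →
      OrliczComm.MaxCommWeakBounded b α Φ Ψ → OrliczComm.MemLip β b := by
    rintro hB ⟨ε, hε, hdec⟩ hbd
    obtain ⟨A, hA, hosc⟩ := OrliczComm.exists_lintegral_oscillation_le hb hΦ hΨ hB hε hdec hbd
    exact OrliczComm.memLip_of_lintegral_oscillation_le hn hβ0 hβ1.le hb hA hosc
  exact ⟨suff, nec, fun hA hB hε => ⟨suff hA, nec hB hε⟩⟩
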